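/- Let $M\ge 0$ be an integer, let $\mu_d\ge 0$ be constants, let $K_{j\to d},L_{j\to d}\ge 0$, and let $g_{j\to d},h_{j\to d}$ be measurable functions, nonnegative on $(0,\infty)$, with $\int_0^\infty g_{j\to d}(u)\,du=\int_0^\infty h_{j\to d}(u)\,du=1$ $(1\le j,d\le M)$. Consider the $M$-variate Ancestor Hawkes process on the time axis $\mathbb{R}$ with these parameters: immigrant events arrive in dimension $d$ according to a Poisson process of constant rate $\mu_d$; independently of everything else, an immigrant event at time $s$ in dimension $j$ generates direct offspring in dimension $d$ according to a Poisson process of rate $K_{j\to d}\,g_{j\to d}(t-s)$, $t>s$, and a triggered (that is, non-immigrant) event at time $s$ in dimension $j$ generates direct offspring in dimension $d$ according to a Poisson process of rate $L_{j\to d}\,h_{j\to d}(t-s)$, $t>s$; the events of the process are all the immigrants and all their descendants. With $(t_i,d_i)$ the times and dimensions of the events, the intensity of dimension $d$ at time $t$ is $$\lambda_d(t)=\mu_d+R_d(t),\qquad R_d(t)=\sum_{i:\,t_i<t,\ i\text{ immigrant}}K_{d_i\to d}\,g_{d_i\to d}(t-t_i)+\sum_{i:\,t_i<t,\ i\text{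 triggered}}L_{d_i\to d}\,h_{d_i\to d}(t-t_i).$$ Let $\mathbf K,\mathbf L$ be the $M\times M$ matrices with $\mathbf K_{dj}=K_{j\to d}$ and $\mathbf L_{dj}=L_{j\to d}$, and let $\mu=(\mu_1,\dots,\mu_M)^{\mathsf T}$. If the spectral radius of $\mathbf L$ satisfies $\rho(\mathbf L)<1$, then $I-\mathbf L$ is invertible, and the mean triggered intensity $\mathbb E[R_d(t)]$ and the mean total intensity $\mathbb E[\lambda_d(t)]$ are finite and constant in $t\in\mathbb{R}$: for all $d$ and $t$, $\mathbb E[R_d(t)]=r_d$ and $\mathbb E[\lambda_d(t)]=\bar\lambda_d$, where $$r=(I-\mathbf L)^{-1}\mathbf K\,\mu\ \ (\text{with } r_d\ge 0),\qquad \bar\lambda=\mu+(I-\mathbf L)^{-1}\mathbf K\,\mu .$$ Moreover $r_d$ and $\bar\lambda_d$ are the mean numbers of triggered events and of all events in dimension $d$ per unit of time: for every Borel set $A\subseteq\mathbb R$, the expected number of triggered events in dimension $d$ at times in $A$ is $r_d\,|A|$, and the expected number of all events in dimension $d$ at times in $A$ is $\bar\lambda_d\,|A|$, where $|A|$ is the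 Lebesgue measure of $A$ and $0\cdot\infty=0$. -/

import Mathlib

open MeasureTheory ProbabilityTheory Set
open scoped ENNReal

namespace AncestorHawkes

/-! ## Poisson processes on the real line -/

/-- A random, at most countable, list of points of the real line: in the outcome `ω` the points
are `point k ω` for those `k : ℕ` with `k < count ω` (all `k` if `count ω = ⊤`). The values
`point k ω` with `k ≥ count ω` are irrelevant. The list need not be ordered in time. -/
structure PointProcess (Ω : Type*) where
  /-- total number of points -/
  count : Ω → ℕ∞
  /-- location of the `k`-th point -/
  point : ℕ → Ω → ℝ

/-- The random number of points of `N` that lie in `A`. -/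
noncomputable def PointProcess.numIn {Ω : Type*} (N : PointProcess Ω) (A : Set ℝ) (ω : Ω) :
    ℝ≥0∞ :=
  ∑' k : ℕ, {k : ℕ | (k : ℕ∞) < N.count ω ∧ N.point k ω ∈ A}.indicator (fun _ => 1) k

/-- The list of points as a single random element of `ℕ∞ × (ℕ → ℝ)`. -/
def PointProcess.toPair {Ω : Type*} (N : PointProcess Ω) (ω : Ω) : ℕ∞ × (ℕ → ℝ) :=
  (N.count ω, fun k => N.point k ω)

/-- `N` is a Poisson process with intensity measure `Λ`: the number of points in a Borel set `A`
with `Λ A < ∞` is Poisson distributed with mean `Λ A`, and the numbers of points in finitely many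
pairwise disjoint such sets are independent. -/
structure PointProcess.IsPoisson {Ω : Type*} [MeasurableSpace Ω] (N : PointProcess Ω)
    (Λ : Measure ℝ) (P : Measure Ω) : Prop where
  law : ∀ A : Set ℝ, MeasurableSet A → Λ A < ∞ →
    HasLaw (N.numIn A) ((poissonMeasure (Λ A).toNNReal).map (fun n : ℕ => (n : ℝ≥0∞))) P
  indep : ∀ (n : ℕ) (A : Fin n → Set ℝ), (∀ i, MeasurableSet (A i)) → (∀ i, Λ (A i) < ∞) →
    Pairwise (fun i j => Disjoint (A i) (A j)) → iIndepFun (fun i => N.numIn (A i)) P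

/-! ## The Ancestor Hawkes process -/

/-- The parameters of an `M`-variate Ancestor Hawkes process. -/
structure Parameters (M : ℕ) where
  /-- `μ d t` is the background rate in dimension `d` at time `t` -/
  μ : Fin M → ℝ → ℝ
  /-- `K j d` is `K_{j → d}`, the influence of an immigrant event in dimension `j` on `d` -/
  K : Fin M → Fin M → ℝ
  /-- `L j d` is `L_{j → d}`, the influence of a triggered event in dimension `j` on `d` -/
  L : Fin M → Fin M → ℝ
  /-- `g j d` is the influence kernel `g_{j → d}` of immigrant events -/
  g : Fin M → Fin M → ℝ → ℝ
  /-- `h j d` is the influence kernel `h_{j → d}` of triggered events -/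
  h : Fin M → Fin M → ℝ → ℝ

/-- The matrix `𝐊` in the column-vector convention, `𝐊_{d j} = K_{j → d}`. -/
def Parameters.matK {M : ℕ} (θ : Parameters M) : Matrix (Fin M) (Fin M) ℝ :=
  Matrix.of fun d j => θ.K j d

/-- The matrix `𝐋` in the column-vector convention, `𝐋_{d j} = L_{j → d}`. -/
def Parameters.matL {M : ℕ} (θ : Parameters M) : Matrix (Fin M) (Fin M) ℝ :=
  Matrix.of fun d j => θ.L j d

/-- Names of the potential events, recording the branching structure: `immigrant d k` is the
`k`-th immigrant in dimension `d`, and `child u d k` is the `k`-th direct child in dimension `d` of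
the event `u`. So the branching variable is `0` for `immigrant d k`, and `u` for `child u d k`. -/
inductive Event (M : ℕ) : Type where
  | immigrant (d : Fin M) (k : ℕ) : Event M
  | child (u : Event M) (d : Fin M) (k : ℕ) : Event M

/-- The dimension in which an event occurs. -/
def Event.dim {M : ℕ} : Event M → Fin M
  | .immigrant d _ => d
  | .child _ d _ => d

/-- An event is triggered if it is not an immigrant. -/
def Event.IsTriggered {M : ℕ} : Event M → Prop
  | .immigrant _ _ => False
  | .child _ _ _ => True

/-- The rate at which the event `u` triggers direct offspring in dimension `m`, a time `s > 0`
after `u`: `K_{d → m} g_{d → m}(s)` if `u` is an immigrant event in dimension `d`, and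
`L_{d → m} h_{d → m}(s)` if `u` is a triggered event in dimension `d`. -/
def Parameters.influence {M : ℕ} (θ : Parameters M) : Event M → Fin M → ℝ → ℝ
  | .immigrant d _, m, s => θ.K d m * θ.g d m s
  | .child _ d _, m, s => θ.L d m * θ.h d m s

/-- A driving family: `N none d` lists the times of the immigrants in dimension `d`, and
`N (some u) d` lists the waiting times between the event `u` and its direct children in
dimension `d`. -/
abbrev Family (M : ℕ) (Ω : Type*) := Option (Event M) → Fin M → PointProcess Ω

/-- `Occurs N u ω`: in the outcome `ω`, the potential event `u` really happens. -/
def Occurs {M : ℕ} {Ω : Type*} (N : Family M Ω) : Event M → Ω → Prop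
  | .immigrant d k, ω => (k : ℕ∞) < (N none d).count ω
  | .child u d k, ω => Occurs N u ω ∧ (k : ℕ∞) < (N (some u) d).count ω

/-- The time of the event `u`. -/
def time {M : ℕ} {Ω : Type*} (N : Family M Ω) : Event M → Ω → ℝ
  | .immigrant d k, ω => (N none d).point k ω
  | .child u d k, ω => time N u ω + (N (some u) d).point k ω

/-- Cluster representation of the Ancestor Hawkes process with parameters `θ` on the whole time
axis `ℝ`: immigrants arrive in dimension `d` according to a Poisson process with rate `μ_d(t)`;
every event `u`, independently of everything else, generates direct offspring in dimension `d`
according to a Poisson process whose rate at a time `s > 0` after `u` is `θ.influence u d s`.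
The events of the process are the events `u` with `Occurs N u ω`, at the times `time N u ω`. -/
structure IsAncestorHawkes {M : ℕ} {Ω : Type*} [MeasurableSpace Ω] (θ : Parameters M)
    (N : Family M Ω) (P : Measure Ω) : Prop where
  measurable : ∀ i d, Measurable (N i d).toPair
  indep : iIndepFun (fun p : Option (Event M) × Fin M => (N p.1 p.2).toPair) P
  background : ∀ d, (N none d).IsPoisson
    (volume.withDensity fun t => ENNReal.ofReal (θ.μ d t)) P
  offspring : ∀ u d, (N (some u) d).IsPoisson
    ((volume.restrict (Ioi 0)).withDensity fun s => ENNReal.ofReal (θ.influence u d s)) P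

/-- The triggered part of the intensity of dimension `d` at time `t`:
`∑_{i : t_i < t, B_i = 0} K_{d_i → d} g_{d_i → d}(t - t_i)
  + ∑_{i : t_i < t, B_i > 0} L_{d_i → d} h_{d_i → d}(t - t_i)`. -/
noncomputable def triggeredIntensity {M : ℕ} {Ω : Type*} (θ : Parameters M) (N : Family M Ω)
    (d : Fin M) (t : ℝ) (ω : Ω) : ℝ≥0∞ :=
  ∑' u : Event M, {u | Occurs N u ω ∧ time N u ω < t}.indicator
    (fun u => ENNReal.ofReal (θ.influence u d (t - time N u ω))) u

/-- The intensity `λ_d(t)`: background rate plus triggered part. -/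
noncomputable def intensity {M : ℕ} {Ω : Type*} (θ : Parameters M) (N : Family M Ω)
    (d : Fin M) (t : ℝ) (ω : Ω) : ℝ≥0∞ :=
  ENNReal.ofReal (θ.μ d t) + triggeredIntensity θ N d t ω

/-- The number of triggered events in dimension `d` at times in `A`. -/
noncomputable def numTriggered {M : ℕ} {Ω : Type*} (N : Family M Ω) (d : Fin M) (A : Set ℝ)
    (ω : Ω) : ℝ≥0∞ :=
  ∑' u : Event M,
    {u : Event M | u.IsTriggered ∧ u.dim = d ∧ Occurs N u ω ∧ time N u ω ∈ A}.indicator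
      (fun _ => 1) u

/-- The number of events (immigrant or triggered) in dimension `d` at times in `A`. -/
noncomputable def numEvents {M : ℕ} {Ω : Type*} (N : Family M Ω) (d : Fin M) (A : Set ℝ)
    (ω : Ω) : ℝ≥0∞ :=
  ∑' u : Event M,
    {u : Event M | u.dim = d ∧ Occurs N u ω ∧ time N u ω ∈ A}.indicator (fun _ => 1) u

/-- The spectral radius of a real square matrix: the largest modulus of a complex eigenvalue. -/
noncomputable def specRadius {M : ℕ} (A : Matrix (Fin M) (Fin M) ℝ) : ℝ≥0∞ :=
  spectralRadius ℂ (A.map (fun x : ℝ => (x : ℂ)))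

end AncestorHawkes

namespace AncestorHawkes

/-! Sort the events by generation, that is, by number of ancestors. By Campbell's formula the
immigrants have mean measure `μ d` times Lebesgue measure. The offspring process of an event is
independent of whether and when that event occurs, so the mean measure of its children is its own
law convolved with the offspring intensity (`eventLaw_child`, `tsum_lintegral_child`). Convolving
Lebesgue measure with a finite measure only multiplies it by the total mass. Hence every generation
has constant mean density, the shapes of the kernels disappear, and generation n + 1 has density
𝐋ⁿ𝐊μ (`tsum_lintegral_generation`). As ρ(𝐋) < 1, the Neumann series adds these up to r = (1 - 𝐋)⁻¹𝐊μ
(`tsum_generationRate`).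

The mean counts follow at once. The mean triggered intensity is the integral of the kernels against
the mean measures, namely 𝐊μ + 𝐋r, which equals r by the balance equation `tsum_generationRate_eq`.
Expectations and sums over events live in `ℝ≥0∞`, so exchanging them needs only measurability and
countability. -/

open scoped NNReal in
theorem lintegral_natCast_poissonMeasure (r : ℝ≥0) :
    ∫⁻ n : ℕ, (n : ℝ≥0∞) ∂poissonMeasure r = r := by
  have h0 := ProbabilityTheory.hasSum_one_poissonMeasure r
  have hs : HasSum (fun n : ℕ => Real.exp (-r) * r ^ n / (n.factorial : ℝ) * n) (r : ℝ) := by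
    -- The term n = 0 vanishes; after the shift, n + 1 cancels against the factorial and leaves r
    -- times the Poisson weights.
    rw [← hasSum_nat_add_iff' 1]
    simp only [Finset.range_one, Finset.sum_singleton, Nat.cast_zero, mul_zero, sub_zero]
    have e : (fun n : ℕ => Real.exp (-r) * r ^ (n + 1) / ((n + 1).factorial : ℝ) * ((n + 1 : ℕ) : ℝ)) =
        fun n : ℕ => (r : ℝ) * (Real.exp (-r) * r ^ n / (n.factorial : ℝ)) := by
      ext n
      rw [Nat.factorial_succ]
      push_cast
      field_simp
      ring
    rw [e]
    simpa using h0.mul_left (r : ℝ)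
  rw [poissonMeasure, lintegral_sum_measure]
  simp only [lintegral_smul_measure, lintegral_dirac, smul_eq_mul]
  have e : (r : ℝ≥0∞) =
      ENNReal.ofReal (∑' n : ℕ, Real.exp (-r) * r ^ n / (n.factorial : ℝ) * n) := by
    rw [hs.tsum_eq, ENNReal.ofReal_coe_nnreal]
  rw [e, ENNReal.ofReal_tsum_of_nonneg (fun n => by positivity) hs.summable]
  refine tsum_congr fun n => ?_
  rw [ENNReal.ofReal_mul (by positivity), ENNReal.ofReal_natCast]

/-! ### Generations and the information they depend on -/

/-- The number of ancestors of an event. -/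
def Event.depth {M : ℕ} : Event M → ℕ
  | .immigrant _ _ => 0
  | .child u _ _ => u.depth + 1

/-- The indices of the point processes that determine the events with at most `n` ancestors. -/
def pastIndices (M n : ℕ) : Set (Option (Event M) × Fin M) :=
  {p | ∀ v ∈ p.1, v.depth < n}

theorem pastIndices_mono {M m n : ℕ} (h : m ≤ n) : pastIndices M m ⊆ pastIndices M n :=
  fun _ hp v hv => (hp v hv).trans_le h

/-- The information in the point processes with indices in `S`. -/
abbrev sigmaOf {M : ℕ} {Ω : Type*} (N : Family M Ω) (S : Set (Option (Event M) × Fin M)) : MeasurableSpace Ω :=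
  ⨆ p ∈ S, MeasurableSpace.comap (N p.1 p.2).toPair inferInstance

theorem sigmaOf_mono {M : ℕ} {Ω : Type*} (N : Family M Ω) {S T : Set (Option (Event M) × Fin M)} (h : S ⊆ T) :
    sigmaOf N S ≤ sigmaOf N T := biSup_mono h

theorem measurable_sigmaOf {M : ℕ} {Ω : Type*} (N : Family M Ω) {S : Set (Option (Event M) × Fin M)}
    {p : Option (Event M) × Fin M} (hp : p ∈ S) : Measurable[sigmaOf N S] (N p.1 p.2).toPair :=
  measurable_iff_comap_le.2
    (le_biSup (fun p : Option (Event M) × Fin M =>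
      MeasurableSpace.comap (N p.1 p.2).toPair inferInstance) hp)

variable {Ω : Type*} [MeasurableSpace Ω] {P : Measure Ω}

/-! ### Mean measure of a point process -/

/-- The law of the `k`-th point of a point process, on the outcomes in which it exists. -/
noncomputable def PointProcess.pointLaw (N : PointProcess Ω) (P : Measure Ω) (k : ℕ) : Measure ℝ :=
  (P.restrict {ω | (k : ℕ∞) < N.count ω}).map (N.point k)

theorem PointProcess.measurable_count {N : PointProcess Ω} (hN : Measurable N.toPair) :
    Measurable N.count := measurable_fst.comp hN

theorem PointProcess.measurable_point {N : PointProcess Ω} (hN : Measurable N.toPair) (k : ℕ) :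
    Measurable (N.point k) := (measurable_pi_apply k).comp (measurable_snd.comp hN)

theorem PointProcess.measurableSet_lt_count {N : PointProcess Ω} (hN : Measurable N.toPair)
    (k : ℕ) : MeasurableSet {ω | (k : ℕ∞) < N.count ω} :=
  PointProcess.measurable_count hN (MeasurableSet.of_discrete (s := {c : ℕ∞ | (k : ℕ∞) < c}))

instance [IsFiniteMeasure P] (N : PointProcess Ω) (k : ℕ) : IsFiniteMeasure (N.pointLaw P k) := by
  unfold PointProcess.pointLaw; infer_instance

theorem PointProcess.lintegral_numIn {N : PointProcess Ω} (hN : Measurable N.toPair) {A : Set ℝ}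
    (hA : MeasurableSet A) :
    ∫⁻ ω, N.numIn A ω ∂P = Measure.sum (fun k => N.pointLaw P k) A := by
  have hs : ∀ k : ℕ, MeasurableSet {ω | (k : ℕ∞) < N.count ω ∧ N.point k ω ∈ A} := fun k =>
    (PointProcess.measurableSet_lt_count hN k).inter (PointProcess.measurable_point hN k hA)
  have he : ∀ k ω, ({k : ℕ | (k : ℕ∞) < N.count ω ∧ N.point k ω ∈ A}.indicator
      (fun _ => (1 : ℝ≥0∞)) k) =
      {ω | (k : ℕ∞) < N.count ω ∧ N.point k ω ∈ A}.indicator (fun _ => 1) ω := fun k ω => rfl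
  simp only [PointProcess.numIn, he]
  rw [lintegral_tsum fun k => (measurable_const.indicator (hs k)).aemeasurable,
    Measure.sum_apply _ hA]
  refine tsum_congr fun k => ?_
  rw [lintegral_indicator (hs k), setLIntegral_const, one_mul, PointProcess.pointLaw,
    Measure.map_apply (PointProcess.measurable_point hN k) hA,
    Measure.restrict_apply (PointProcess.measurable_point hN k hA), inter_comm]
  rfl

/-- The mean measure of a Poisson process is its intensity measure. -/
theorem PointProcess.IsPoisson.sum_pointLaw {N : PointProcess Ω} {Λ : Measure ℝ} [SigmaFinite Λ]
    (hP : N.IsPoisson Λ P) (hN : Measurable N.toPair) :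
    Measure.sum (fun k => N.pointLaw P k) = Λ := by
  have hfin : ∀ A, MeasurableSet A → Λ A < ∞ → Measure.sum (fun k => N.pointLaw P k) A = Λ A := by
    intro A hA hlt
    rw [← PointProcess.lintegral_numIn hN hA]
    have := (hP.law A hA hlt).lintegral_comp (f := fun x => x) measurable_id.aemeasurable
    rw [this, lintegral_map (f := fun x => x) measurable_id .of_discrete, lintegral_natCast_poissonMeasure,
      ENNReal.coe_toNNReal hlt.ne]
  -- The Poisson law is given only on sets of finite intensity, so the two measures are compared on
  -- an exhaustion by such sets.
  refine (Measure.ext_of_iUnion_eq_univ (iUnion_spanningSets Λ) fun i => ?_).symm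
  ext A hA
  rw [Measure.restrict_apply hA, Measure.restrict_apply hA,
    hfin _ (hA.inter (measurableSet_spanningSets Λ i))
      ((measure_mono inter_subset_right).trans_lt (measure_spanningSets_lt_top Λ i))]

variable {M : ℕ}

/-! ### Laws of event times -/

/-- The law of the time of an event, on the outcomes in which it occurs. -/
noncomputable def eventLaw (N : Family M Ω) (P : Measure Ω) (u : Event M) : Measure ℝ :=
  (P.restrict {ω | Occurs N u ω}).map (time N u)

/-- Going from `u` to a child uses one new process, indexed by `some u`. The strict inequality in
`pastIndices` leaves out the offspring processes of `u` itself, which is what makes them independent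
of `u`. -/
theorem measurable_event {M : ℕ} {Ω : Type*} (N : Family M Ω) (u : Event M) :
    MeasurableSet[sigmaOf N (pastIndices M u.depth)] {ω | Occurs N u ω} ∧
      Measurable[sigmaOf N (pastIndices M u.depth)] (time N u) := by
  induction u with
  | immigrant d k =>
    have h := measurable_sigmaOf N (S := pastIndices M (Event.immigrant d k).depth)
      (p := (none, d)) (by simp [pastIndices])
    let _ := sigmaOf N (pastIndices M (Event.immigrant d k).depth)
    exact ⟨PointProcess.measurableSet_lt_count h k, PointProcess.measurable_point h k⟩
  | child u d k ih =>
    have h := measurable_sigmaOf N (S := pastIndices M (Event.child u d k).depth)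
      (p := (some u, d)) (by simp [pastIndices, Event.depth])
    have hle := sigmaOf_mono N (pastIndices_mono (M := M)
      (show u.depth ≤ (Event.child u d k).depth from Nat.le_succ _))
    have h1 := hle _ ih.1
    have h2 := ih.2.mono hle le_rfl
    let _ := sigmaOf N (pastIndices M (Event.child u d k).depth)
    exact ⟨h1.inter (PointProcess.measurableSet_lt_count h k),
      h2.add (PointProcess.measurable_point h k)⟩

theorem sigmaOf_le {N : Family M Ω} (hN : ∀ i d, Measurable (N i d).toPair)
    (S : Set (Option (Event M) × Fin M)) : sigmaOf N S ≤ ‹MeasurableSpace Ω› :=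
  iSup₂_le fun p _ => (hN p.1 p.2).comap_le

theorem measurableSet_occurs {N : Family M Ω} (hN : ∀ i d, Measurable (N i d).toPair)
    (u : Event M) : MeasurableSet {ω | Occurs N u ω} :=
  sigmaOf_le hN _ _ (measurable_event N u).1

theorem measurable_time {N : Family M Ω} (hN : ∀ i d, Measurable (N i d).toPair)
    (u : Event M) : Measurable (time N u) :=
  (measurable_event N u).2.mono (sigmaOf_le hN _) le_rfl

open scoped MeasureTheory in
/-- The waiting time of a child is independent of the time of its parent. -/
theorem eventLaw_child [IsFiniteMeasure P] {N : Family M Ω}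
    (hN : ∀ i d, Measurable (N i d).toPair)
    (hI : iIndepFun (fun p : Option (Event M) × Fin M => (N p.1 p.2).toPair) P)
    (u : Event M) (d : Fin M) (k : ℕ) :
    eventLaw N P (.child u d k) = eventLaw N P u ∗ (N (some u) d).pointLaw P k := by
  have hind : Indep (sigmaOf N (pastIndices M u.depth)) (sigmaOf N {(some u, d)}) P := by
    refine indep_iSup_of_disjoint
      (m := fun p : Option (Event M) × Fin M => MeasurableSpace.comap (N p.1 p.2).toPair inferInstance)
      (fun p => (hN p.1 p.2).comap_le) hI.iIndep ?_
    simp [pastIndices]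
  have hX := measurable_time hN u
  have hO := measurableSet_occurs hN u
  have hY := PointProcess.measurable_point (hN (some u) d) k
  have hC := PointProcess.measurableSet_lt_count (hN (some u) d) k
  have hfin : IsFiniteMeasure (eventLaw N P u) := by unfold eventLaw; infer_instance
  -- Independence on rectangles shows that the joint law, restricted to the outcomes in which parent
  -- and child both occur, is a product; its image under addition is the convolution.
  have hprod : (eventLaw N P u).prod ((N (some u) d).pointLaw P k) =
      (P.restrict ({ω | Occurs N u ω} ∩ {ω | (k : ℕ∞) < (N (some u) d).count ω})).map
        (fun ω => (time N u ω, (N (some u) d).point k ω)) := by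
    refine Measure.prod_eq fun s t hs ht => ?_
    have h2 := measurable_sigmaOf N (S := {(some u, d)}) (p := (some u, d)) rfl
    have hind' := (Indep_iff _ _ _).1 hind
      ({ω | Occurs N u ω} ∩ time N u ⁻¹' s)
      ({ω | (k : ℕ∞) < (N (some u) d).count ω} ∩ (N (some u) d).point k ⁻¹' t)
      ((measurable_event N u).1.inter ((measurable_event N u).2 hs))
      (by
        let _ := sigmaOf N {(some u, d)}
        exact (PointProcess.measurableSet_lt_count h2 k).inter
          (PointProcess.measurable_point h2 k ht))
    rw [Measure.map_apply (hX.prodMk hY) (hs.prod ht),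
      Measure.restrict_apply (hX.prodMk hY (hs.prod ht)), eventLaw, PointProcess.pointLaw,
      Measure.map_apply hX hs, Measure.map_apply hY ht, Measure.restrict_apply (hX hs),
      Measure.restrict_apply (hY ht), inter_comm (time N u ⁻¹' s),
      inter_comm ((N (some u) d).point k ⁻¹' t), ← hind']
    congr 1
    ext ω
    simp only [mem_inter_iff, mem_preimage, mem_prod]
    tauto
  rw [Measure.conv, hprod, Measure.map_map (by fun_prop) (hX.prodMk hY)]
  rfl

theorem lintegral_eventLaw {N : Family M Ω} (hN : ∀ i d, Measurable (N i d).toPair)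
    (u : Event M) {f : ℝ → ℝ≥0∞} (hf : Measurable f) :
    ∫⁻ x, f x ∂eventLaw N P u = ∫⁻ ω, {ω | Occurs N u ω}.indicator (fun ω => f (time N u ω)) ω ∂P := by
  rw [eventLaw, lintegral_map hf (measurable_time hN u),
    lintegral_indicator (measurableSet_occurs hN u)]

/-! ### Neumann series -/

open Filter Topology in
/-- In a complex Banach algebra, an element of spectral radius less than `1` has summable powers. -/
theorem summable_norm_pow_of_spectralRadius_lt_one {A : Type*} [NormedRing A] [NormedAlgebra ℂ A]
    [CompleteSpace A] {a : A} (ha : spectralRadius ℂ a < 1) : Summable fun n : ℕ => ‖a ^ n‖ := by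
  obtain ⟨q, hq, hq1⟩ := ENNReal.lt_iff_exists_nnreal_btwn.1 ha
  have hq1' : (q : ℝ) < 1 := by exact_mod_cast hq1
  -- Gelfand's formula: the n-th roots of the norms eventually drop below q < 1, so the powers are
  -- dominated by a geometric series.
  have hev := (spectrum.pow_nnnorm_pow_one_div_tendsto_nhds_spectralRadius a).eventually_lt_const hq
  refine Summable.of_norm_bounded_eventually_nat (g := fun n : ℕ => (q : ℝ) ^ n)
    (summable_geometric_of_lt_one q.2 hq1') ?_
  filter_upwards [hev, eventually_gt_atTop 0] with n hn hn0
  have hn0' : (0 : ℝ) < n := by exact_mod_cast hn0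
  have h1 : ((‖a ^ n‖₊ : ℝ≥0∞) ^ (1 / n : ℝ)) ^ (n : ℝ) ≤ (q : ℝ≥0∞) ^ (n : ℝ) :=
    ENNReal.rpow_le_rpow hn.le hn0'.le
  rw [← ENNReal.rpow_mul, one_div_mul_cancel hn0'.ne', ENNReal.rpow_one, ENNReal.rpow_natCast] at h1
  rw [norm_norm]
  exact_mod_cast h1

section

attribute [local instance] Matrix.linftyOpNormedRing Matrix.linftyOpNormedAlgebra

/-- An entry is bounded by the row-sum operator norm of the complexified matrix. The conclusion is
entrywise, so the auxiliary norm stays local. -/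
theorem summable_pow_apply_of_specRadius_lt_one {M : ℕ} {A : Matrix (Fin M) (Fin M) ℝ}
    (hA : specRadius A < 1) (i j : Fin M) : Summable fun n : ℕ => (A ^ n) i j := by
  have hs := summable_norm_pow_of_spectralRadius_lt_one hA
  refine Summable.of_norm_bounded hs fun n => ?_
  have hmap : (A.map (fun x : ℝ => (x : ℂ))) ^ n = (A ^ n).map (fun x : ℝ => (x : ℂ)) := by
    have := (map_pow (Complex.ofRealHom.mapMatrix (m := Fin M)) A n).symm
    exact this
  rw [hmap]
  have h1 : ‖(A ^ n) i j‖₊ ≤ ‖(A ^ n).map (fun x : ℝ => (x : ℂ))‖₊ := by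
    rw [Matrix.linfty_opNNNorm_def]
    refine le_trans ?_ (Finset.le_sup (Finset.mem_univ i))
    refine le_trans ?_ (Finset.single_le_sum (fun _ _ => zero_le) (Finset.mem_univ j))
    simp
  exact_mod_cast h1

end

/-- The Neumann series of a matrix of spectral radius less than `1`. -/
theorem hasSum_pow_of_specRadius_lt_one {M : ℕ} {A : Matrix (Fin M) (Fin M) ℝ}
    (hA : specRadius A < 1) : IsUnit (1 - A) ∧ HasSum (fun n : ℕ => A ^ n) (1 - A)⁻¹ := by
  have hs : Summable fun n : ℕ => A ^ n :=
    Pi.summable.2 fun i => Pi.summable.2 fun j => summable_pow_apply_of_specRadius_lt_one hA i j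
  -- Telescoping: subtracting the shifted series leaves only the term n = 0.
  have h1 : (∑' n : ℕ, A ^ n) * (1 - A) = 1 := by
    have e := hs.hasSum.mul_right (1 - A)
    have e2 := (hs.hasSum.sub ((hasSum_nat_add_iff' 1).2 hs.hasSum))
    have e3 := e.unique (by simpa [mul_sub, pow_succ] using e2)
    simpa using e3
  have h2 := Matrix.inv_eq_left_inv h1
  refine ⟨?_, h2 ▸ hs.hasSum⟩
  exact IsUnit.of_mul_eq_one_right _ h1

/-! ### Sums over the tree of events -/

/-- An event is an immigrant or the child of another event. -/
def Event.equivSum (M : ℕ) : (Fin M × ℕ) ⊕ (Event M × Fin M × ℕ) ≃ Event M where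
  toFun := Sum.elim (fun p => .immigrant p.1 p.2) (fun p => .child p.1 p.2.1 p.2.2)
  invFun
    | .immigrant d k => .inl (d, k)
    | .child u d k => .inr (u, d, k)
  left_inv := by rintro (p | p) <;> rfl
  right_inv := by rintro (_ | _) <;> rfl

theorem Event.tsum_eq {M : ℕ} (F : Event M → ℝ≥0∞) :
    ∑' u, F u = (∑ d, ∑' k, F (.immigrant d k)) + ∑' u, ∑ d, ∑' k, F (.child u d k) := by
  rw [← (Event.equivSum M).tsum_eq F, Summable.tsum_sum ENNReal.summable ENNReal.summable,
    ENNReal.tsum_prod', ENNReal.tsum_prod', tsum_fintype]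
  congr 1
  refine tsum_congr fun u => ?_
  rw [ENNReal.tsum_prod', tsum_fintype]
  rfl

/-- An injective numbering of the events. -/
def Event.code {M : ℕ} : Event M → ℕ
  -- Parity separates immigrants from children.
  | .immigrant d k => 2 * Nat.pair d k
  | .child u d k => 2 * Nat.pair u.code (Nat.pair d k) + 1

theorem Event.code_injective {M : ℕ} : Function.Injective (Event.code (M := M)) := by
  intro u
  induction u with
  | immigrant d k =>
    rintro (⟨d', k'⟩ | ⟨v, d', k'⟩) h <;> simp only [Event.code] at h
    · obtain ⟨h1, h2⟩ := Nat.pair_eq_pair.1 (show Nat.pair d k = Nat.pair d' k' by omega)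
      rw [Fin.ext h1, h2]
    · omega
  | child u d k ih =>
    rintro (⟨d', k'⟩ | ⟨v, d', k'⟩) h <;> simp only [Event.code] at h
    · omega
    · obtain ⟨h1, h2⟩ := Nat.pair_eq_pair.1 (show Nat.pair u.code (Nat.pair d k) =
        Nat.pair v.code (Nat.pair d' k') by omega)
      obtain ⟨h3, h4⟩ := Nat.pair_eq_pair.1 h2
      rw [ih h1, Fin.ext h3, h4]

/-- Needed to exchange expectations with sums over all events. -/
instance (M : ℕ) : Countable (Event M) := Event.code_injective.countable

@[simp] theorem Event.depth_immigrant {M : ℕ} (d : Fin M) (k : ℕ) :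
    (Event.immigrant d k).depth = 0 := rfl

@[simp] theorem Event.depth_child {M : ℕ} (u : Event M) (d : Fin M) (k : ℕ) :
    (Event.child u d k).depth = u.depth + 1 := rfl

@[simp] theorem Event.dim_immigrant {M : ℕ} (d : Fin M) (k : ℕ) :
    (Event.immigrant d k).dim = d := rfl

@[simp] theorem Event.dim_child {M : ℕ} (u : Event M) (d : Fin M) (k : ℕ) :
    (Event.child u d k).dim = d := rfl

theorem Event.isTriggered_iff {M : ℕ} (u : Event M) : u.IsTriggered ↔ u.depth ≠ 0 := by
  cases u <;> simp [Event.IsTriggered]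

/-! ### Mean densities of the generations -/

/-- The influence of an event with `n` ancestors in dimension `j` on dimension `d`. -/
noncomputable def Parameters.influenceAt {M : ℕ} (θ : Parameters M) (n : ℕ) (j d : Fin M) (s : ℝ) :
    ℝ :=
  if n = 0 then θ.K j d * θ.g j d s else θ.L j d * θ.h j d s

theorem Parameters.influence_eq {M : ℕ} (θ : Parameters M) (u : Event M) (d : Fin M) :
    θ.influence u d = θ.influenceAt u.depth u.dim d := by
  ext s
  cases u <;> simp [Parameters.influence, Parameters.influenceAt]

/-- The mean number of direct offspring in dimension `d` of an event with `n` ancestors in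
dimension `j`. -/
noncomputable def Parameters.meanOffspring {M : ℕ} (θ : Parameters M) (n : ℕ) (j d : Fin M) : ℝ :=
  if n = 0 then θ.K j d else θ.L j d

/-- The mean number per unit of time of events with `n` ancestors in dimension `d`, if immigrants
arrive at the constant rates `μ`. -/
noncomputable def Parameters.generationRate {M : ℕ} (θ : Parameters M) (μ : Fin M → ℝ) :
    ℕ → Fin M → ℝ≥0∞
  | 0, d => ENNReal.ofReal (μ d)
  | n + 1, d => ∑ j, θ.generationRate μ n j * ENNReal.ofReal (θ.meanOffspring n j d)

/-- The intensity measure of the direct offspring in dimension `d` of an event with `n` ancestors in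
dimension `j`. -/
noncomputable def Parameters.offspringMeasure {M : ℕ} (θ : Parameters M) (n : ℕ) (j d : Fin M) :
    Measure ℝ :=
  (volume.restrict (Ioi 0)).withDensity fun s => ENNReal.ofReal (θ.influenceAt n j d s)

/-- Translation invariance of Lebesgue measure. This is what carries stationarity from one
generation to the next. -/
theorem lintegral_lintegral_add_eq {f : ℝ → ℝ≥0∞} (hf : Measurable f) (κ : Measure ℝ) [SFinite κ] :
    ∫⁻ x, ∫⁻ y, f (x + y) ∂κ = κ univ * ∫⁻ x, f x := by
  rw [lintegral_lintegral_swap (by fun_prop)]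
  simp_rw [lintegral_add_right_eq_self]
  rw [lintegral_const, mul_comm]

section Generations

variable {M : ℕ} {Ω : Type*} [MeasurableSpace Ω] {P : Measure Ω} {θ : Parameters M} {N : Family M Ω} {μ : Fin M → ℝ}

theorem IsAncestorHawkes.tsum_lintegral_immigrant (hN : IsAncestorHawkes θ N P)
    (hμ : ∀ d t, θ.μ d t = μ d) (d : Fin M) (f : ℝ → ℝ≥0∞) :
    ∑' k, ∫⁻ x, f x ∂eventLaw N P (.immigrant d k) = ENNReal.ofReal (μ d) * ∫⁻ x, f x := by
  have hb := hN.background d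
  simp only [hμ] at hb
  rw [withDensity_const] at hb
  have := SMul.sigmaFinite (μ := (volume : Measure ℝ)) (μ d).toNNReal
  have h := PointProcess.IsPoisson.sum_pointLaw (Λ := (μ d).toNNReal • (volume : Measure ℝ)) hb
    (hN.measurable none d)
  rw [← lintegral_sum_measure]
  change ∫⁻ x, f x ∂Measure.sum (fun k => (N none d).pointLaw P k) = _
  rw [h]
  exact lintegral_smul_measure _ _

/-- Each child's law is a convolution, and the waiting-time laws add up over `k` to the offspring
intensity. -/
theorem IsAncestorHawkes.tsum_lintegral_child [IsFiniteMeasure P] (hN : IsAncestorHawkes θ N P)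
    (hθ : ∀ n j d, θ.offspringMeasure n j d univ = ENNReal.ofReal (θ.meanOffspring n j d))
    (u : Event M) (d : Fin M) {f : ℝ → ℝ≥0∞} (hf : Measurable f) :
    ∑' k, ∫⁻ x, f x ∂eventLaw N P (.child u d k) =
      ∫⁻ x, ∫⁻ y, f (x + y) ∂θ.offspringMeasure u.depth u.dim d ∂eventLaw N P u := by
  have ho := hN.offspring u d
  rw [θ.influence_eq] at ho
  have hfin : IsFiniteMeasure (θ.offspringMeasure u.depth u.dim d) :=
    ⟨by rw [hθ]; exact ENNReal.ofReal_lt_top⟩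
  rw [← PointProcess.IsPoisson.sum_pointLaw (Λ := θ.offspringMeasure u.depth u.dim d) ho
    (hN.measurable (some u) d)]
  simp_rw [lintegral_sum_measure]
  rw [lintegral_tsum fun k => by fun_prop]
  refine tsum_congr fun k => ?_
  rw [eventLaw_child hN.measurable hN.indep, Measure.lintegral_conv hf]

/-- The events with `n` ancestors in dimension `d` have constant mean density. -/
theorem IsAncestorHawkes.tsum_lintegral_generation [IsFiniteMeasure P] (hN : IsAncestorHawkes θ N P)
    (hμ : ∀ d t, θ.μ d t = μ d)
    (hθ : ∀ n j d, θ.offspringMeasure n j d univ = ENNReal.ofReal (θ.meanOffspring n j d))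
    (n : ℕ) (d : Fin M) {f : ℝ → ℝ≥0∞} (hf : Measurable f) :
    ∑' u : Event M, (if u.depth = n ∧ u.dim = d then ∫⁻ x, f x ∂eventLaw N P u else 0) =
      θ.generationRate μ n d * ∫⁻ x, f x := by
  -- The test function must vary: the inductive step uses the hypothesis for x ↦ ∫ f(x + y) over the
  -- offspring measure.
  induction n generalizing d f with
  | zero =>
    rw [Event.tsum_eq]
    simp only [Event.depth_immigrant, Event.depth_child, Event.dim_immigrant, true_and, Nat.add_eq_zero_iff, one_ne_zero, and_false,
      false_and, if_false, tsum_zero, Finset.sum_const_zero, add_zero]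
    rw [Finset.sum_eq_single d (fun j _ hj => by simp [hj]) (by simp)]
    simpa [Parameters.generationRate] using hN.tsum_lintegral_immigrant hμ d f
  | succ n ih =>
    have hfin : ∀ j, IsFiniteMeasure (θ.offspringMeasure n j d) := fun j =>
      ⟨by rw [hθ]; exact ENNReal.ofReal_lt_top⟩
    rw [Event.tsum_eq]
    -- On the left `j` is the child's dimension, forced to be `d`; on the right it is the parent's
    -- dimension, so that the induction hypothesis applies for each `j`.
    have h1 : ∀ u : Event M, (∑ j, ∑' k, (if (Event.child u j k).depth = n + 1 ∧
        (Event.child u j k).dim = d then ∫⁻ x, f x ∂eventLaw N P (.child u j k) else 0)) =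
        ∑ j, if u.depth = n ∧ u.dim = j then
          ∫⁻ x, ∫⁻ y, f (x + y) ∂θ.offspringMeasure n j d ∂eventLaw N P u else 0 := by
      intro u
      simp only [Event.depth_child, Event.dim_child, Nat.add_right_cancel_iff]
      rw [Finset.sum_eq_single d (fun j _ hj => by simp [hj]) (by simp),
        Finset.sum_eq_single u.dim (fun j _ hj => by simp [hj.symm]) (by simp)]
      by_cases hu : u.depth = n
      · subst hu
        simp [hN.tsum_lintegral_child hθ u d hf]
      · simp [hu]
    simp only [h1]
    simp only [Event.depth_immigrant, (Nat.succ_ne_zero n).symm, false_and, if_false, tsum_zero,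
      Finset.sum_const_zero, zero_add]
    rw [Summable.tsum_finsetSum fun _ _ => ENNReal.summable, Parameters.generationRate,
      Finset.sum_mul]
    refine Finset.sum_congr rfl fun j _ => ?_
    rw [ih j (by fun_prop), lintegral_lintegral_add_eq hf, hθ, mul_assoc]

/-- The triggered events in dimension `d` have constant mean density. -/
theorem IsAncestorHawkes.tsum_lintegral_triggered [IsFiniteMeasure P] (hN : IsAncestorHawkes θ N P)
    (hμ : ∀ d t, θ.μ d t = μ d)
    (hθ : ∀ n j d, θ.offspringMeasure n j d univ = ENNReal.ofReal (θ.meanOffspring n j d))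
    (d : Fin M) {f : ℝ → ℝ≥0∞} (hf : Measurable f) :
    ∑' u : Event M, (if u.depth ≠ 0 ∧ u.dim = d then ∫⁻ x, f x ∂eventLaw N P u else 0) =
      (∑' n, θ.generationRate μ (n + 1) d) * ∫⁻ x, f x := by
  rw [← ENNReal.tsum_mul_right]
  simp_rw [← hN.tsum_lintegral_generation hμ hθ _ d hf]
  rw [ENNReal.tsum_comm]
  refine tsum_congr fun u => ?_
  by_cases hd : u.dim = d
  -- A triggered event lies in exactly one generation of positive depth.
  · cases hu : u.depth with
    | zero => simp
    | succ m =>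
      rw [tsum_eq_single m fun b hb => by simp [hb.symm]]
      simp [hd]
  · simp [hd]

end Generations

/-! ### Total rates and kernel masses -/

/-- The rates of the generations of triggered events sum to `(1 - 𝐋)⁻¹ 𝐊 μ`. -/
theorem Parameters.tsum_generationRate {M : ℕ} (θ : Parameters M)
    (hK : ∀ j d, 0 ≤ θ.K j d) (hL : ∀ j d, 0 ≤ θ.L j d) {μ : Fin M → ℝ} (hμ : ∀ d, 0 ≤ μ d)
    (hρ : specRadius θ.matL < 1) (d : Fin M) :
    0 ≤ ((1 - θ.matL)⁻¹ * θ.matK).mulVec μ d ∧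
    ∑' n, θ.generationRate μ (n + 1) d =
      ENNReal.ofReal (((1 - θ.matL)⁻¹ * θ.matK).mulVec μ d) := by
  have key : ∀ n d, 0 ≤ (θ.matL ^ n * θ.matK).mulVec μ d ∧ θ.generationRate μ (n + 1) d =
      ENNReal.ofReal ((θ.matL ^ n * θ.matK).mulVec μ d) := by
    intro n
    induction n with
    | zero =>
      intro d
      simp only [pow_zero, one_mul, Parameters.generationRate, Parameters.meanOffspring, if_true]
      have h : ∀ j, 0 ≤ θ.K j d * μ j := fun j => mul_nonneg (hK j d) (hμ j)
      simp only [Matrix.mulVec, dotProduct, Parameters.matK, Matrix.of_apply]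
      refine ⟨Finset.sum_nonneg fun j _ => h j, ?_⟩
      rw [ENNReal.ofReal_sum_of_nonneg fun j _ => h j]
      refine Finset.sum_congr rfl fun j _ => ?_
      rw [ENNReal.ofReal_mul (hK j d), mul_comm]
    | succ n ih =>
      intro d
      rw [pow_succ', mul_assoc, ← Matrix.mulVec_mulVec, Parameters.generationRate]
      generalize (θ.matL ^ n * θ.matK).mulVec μ = v at ih
      have h : ∀ j, 0 ≤ θ.L j d * v j := fun j => mul_nonneg (hL j d) (ih j).1
      simp only [Matrix.mulVec, dotProduct, Parameters.matL, Matrix.of_apply]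
      refine ⟨Finset.sum_nonneg fun j _ => h j, ?_⟩
      rw [ENNReal.ofReal_sum_of_nonneg fun j _ => h j]
      refine Finset.sum_congr rfl fun j _ => ?_
      rw [ENNReal.ofReal_mul (hL j d), mul_comm, (ih j).2]
      simp [Parameters.meanOffspring]
  -- The Neumann series is pushed through the continuous additive map A ↦ (A𝐊μ)_d.
  have hs : HasSum (fun n : ℕ => (θ.matL ^ n * θ.matK).mulVec μ d)
      (((1 - θ.matL)⁻¹ * θ.matK).mulVec μ d) := by
    have := (hasSum_pow_of_specRadius_lt_one hρ).2.map
      (AddMonoidHom.mk' (fun A : Matrix (Fin M) (Fin M) ℝ => (A * θ.matK).mulVec μ d)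
        fun A B => by simp [add_mul, Matrix.add_mulVec])
      (by
        change Continuous fun A : Matrix (Fin M) (Fin M) ℝ => (A * θ.matK).mulVec μ d
        exact (continuous_apply d).comp
          ((continuous_id.matrix_mul continuous_const).matrix_mulVec continuous_const))
    exact this
  refine ⟨hs.nonneg fun n => (key n d).1, ?_⟩
  simp_rw [(key _ d).2]
  rw [← ENNReal.ofReal_tsum_of_nonneg (fun n => (key n d).1) hs.summable, hs.tsum_eq]

theorem Parameters.offspringMeasure_univ {M : ℕ} (θ : Parameters M)
    (hK : ∀ j d, 0 ≤ θ.K j d) (hL : ∀ j d, 0 ≤ θ.L j d)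
    (hg_nonneg : ∀ j d, ∀ s, 0 < s → 0 ≤ θ.g j d s)
    (hh_nonneg : ∀ j d, ∀ s, 0 < s → 0 ≤ θ.h j d s)
    (hg_int : ∀ j d, ∫ s in Ioi (0 : ℝ), θ.g j d s = 1)
    (hh_int : ∀ j d, ∫ s in Ioi (0 : ℝ), θ.h j d s = 1) (n : ℕ) (j d : Fin M) :
    θ.offspringMeasure n j d univ = ENNReal.ofReal (θ.meanOffspring n j d) := by
  have key : ∀ (c : ℝ) (f : ℝ → ℝ), 0 ≤ c → (∀ s, 0 < s → 0 ≤ f s) →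
      ∫ s in Ioi (0 : ℝ), f s = 1 →
      ∫⁻ s in Ioi (0 : ℝ), ENNReal.ofReal (c * f s) = ENNReal.ofReal c := by
    intro c f hc hf hf1
    -- A non-integrable function has integral 0 by convention, so the value 1 forces integrability.
    have hi : Integrable f (volume.restrict (Ioi 0)) := by
      by_contra h
      rw [integral_undef h] at hf1
      exact zero_ne_one hf1
    rw [← ofReal_integral_eq_lintegral_ofReal (hi.const_mul c)
      ((ae_restrict_iff' measurableSet_Ioi).2 (.of_forall fun s hs => mul_nonneg hc (hf s hs))),
      integral_const_mul, hf1, mul_one]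
  rw [Parameters.offspringMeasure, withDensity_apply _ .univ, Measure.restrict_univ]
  unfold Parameters.influenceAt Parameters.meanOffspring
  split_ifs
  · exact key _ _ (hK j d) (hg_nonneg j d) (hg_int j d)
  · exact key _ _ (hL j d) (hh_nonneg j d) (hh_int j d)

theorem Parameters.measurable_influenceAt {M : ℕ} {θ : Parameters M}
    (hg : ∀ j d, Measurable (θ.g j d)) (hh : ∀ j d, Measurable (θ.h j d)) (n : ℕ) (j d : Fin M) :
    Measurable (θ.influenceAt n j d) := by
  unfold Parameters.influenceAt
  split_ifs
  · exact (hg j d).const_mul _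
  · exact (hh j d).const_mul _

/-- A stationary stream of unit rate, seen through an influence kernel, has the total influence as
its mean. -/
theorem Parameters.lintegral_influenceAt_sub {M : ℕ} (θ : Parameters M) (n : ℕ) (j d : Fin M)
    (t : ℝ) :
    ∫⁻ x, (Iio t).indicator (fun x => ENNReal.ofReal (θ.influenceAt n j d (t - x))) x =
      θ.offspringMeasure n j d univ := by
  rw [Parameters.offspringMeasure, withDensity_apply _ .univ, Measure.restrict_univ,
    ← lintegral_indicator measurableSet_Ioi, ← lintegral_sub_left_eq_self _ t]
  refine lintegral_congr fun x => ?_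
  simp [indicator]

/-- The balance equation for the total rate of the triggered events. -/
theorem Parameters.tsum_generationRate_eq {M : ℕ} (θ : Parameters M) (μ : Fin M → ℝ) (d : Fin M) :
    ∑' n, θ.generationRate μ (n + 1) d =
      (∑ j, ENNReal.ofReal (μ j) * ENNReal.ofReal (θ.meanOffspring 0 j d)) +
        ∑ j, (∑' n, θ.generationRate μ (n + 1) j) * ENNReal.ofReal (θ.meanOffspring 1 j d) := by
  rw [tsum_eq_zero_add' (f := fun n => θ.generationRate μ (n + 1) d) ENNReal.summable]
  simp_rw [← ENNReal.tsum_mul_right]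
  rw [← Summable.tsum_finsetSum fun _ _ => ENNReal.summable]
  -- All generations n ≥ 1 share the offspring means 𝐋, and `meanOffspring` computes to them.
  rfl

/-! ### Expectations of intensities and counts -/

section Means

variable {M : ℕ} {Ω : Type*} [MeasurableSpace Ω] {P : Measure Ω}
  {θ : Parameters M} {N : Family M Ω} {μ : Fin M → ℝ}

/-- Campbell's formula for the whole process: expectations reduce to the laws of single events. -/
theorem lintegral_tsum_event (hN : ∀ i d, Measurable (N i d).toPair) {F : Event M → ℝ → ℝ≥0∞}
    (hF : ∀ u, Measurable (F u)) :
    ∫⁻ ω, ∑' u, {ω | Occurs N u ω}.indicator (fun ω => F u (time N u ω)) ω ∂P =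
      ∑' u, ∫⁻ x, F u x ∂eventLaw N P u := by
  have hm : ∀ u, Measurable ({ω | Occurs N u ω}.indicator fun ω => F u (time N u ω)) := fun u =>
    ((hF u).comp (measurable_time hN u)).indicator (measurableSet_occurs hN u)
  rw [lintegral_tsum fun u => (hm u).aemeasurable]
  exact tsum_congr fun u => (lintegral_eventLaw hN u (hF u)).symm

variable [IsFiniteMeasure P]

/-- Immigrants act through the kernel `F 0` and all triggered events through `F 1`. Each constant
density is multiplied by the mass of its kernel, which gives the right side of the balance equation.
-/
theorem IsAncestorHawkes.lintegral_triggeredIntensity (hN : IsAncestorHawkes θ N P)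
    (hg : ∀ j d, Measurable (θ.g j d)) (hh : ∀ j d, Measurable (θ.h j d))
    (hμ : ∀ d t, θ.μ d t = μ d)
    (hθ : ∀ n j d, θ.offspringMeasure n j d univ = ENNReal.ofReal (θ.meanOffspring n j d))
    (d : Fin M) (t : ℝ) :
    ∫⁻ ω, triggeredIntensity θ N d t ω ∂P = ∑' n, θ.generationRate μ (n + 1) d := by
  set F : ℕ → Fin M → ℝ → ℝ≥0∞ := fun n j =>
    (Iio t).indicator (fun x => ENNReal.ofReal (θ.influenceAt n j d (t - x))) with hFdef
  have hF : ∀ n j, Measurable (F n j) := fun n j =>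
    ((Parameters.measurable_influenceAt hg hh n j d).comp
      (measurable_const.sub measurable_id)).ennreal_ofReal.indicator measurableSet_Iio
  have hF1 : ∀ n j, n ≠ 0 → F n j = F 1 j := fun n j hn => by
    simp [hFdef, Parameters.influenceAt, hn]
  have h1 : ∀ ω, triggeredIntensity θ N d t ω =
      ∑' u : Event M, {ω | Occurs N u ω}.indicator (fun ω => F u.depth u.dim (time N u ω)) ω := by
    intro ω
    refine tsum_congr fun u => ?_
    by_cases ho : Occurs N u ω <;> by_cases ht : time N u ω < t <;>
      simp [hFdef, ho, ht, θ.influence_eq]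
  simp_rw [h1]
  rw [lintegral_tsum_event hN.measurable fun u => hF _ _, θ.tsum_generationRate_eq]
  -- Exactly one summand on the right can be nonzero, the one matching the type and dimension of
  -- `u`.
  have h2 : ∀ u : Event M, ∫⁻ x, F u.depth u.dim x ∂eventLaw N P u =
      (∑ j, if u.depth = 0 ∧ u.dim = j then ∫⁻ x, F 0 j x ∂eventLaw N P u else 0) +
        ∑ j, if u.depth ≠ 0 ∧ u.dim = j then ∫⁻ x, F 1 j x ∂eventLaw N P u else 0 := by
    intro u
    by_cases hu : u.depth = 0
    · simp [hu]
    · simp [hu, hF1 _ _ hu]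
  simp_rw [h2]
  rw [ENNReal.tsum_add, Summable.tsum_finsetSum fun _ _ => ENNReal.summable,
    Summable.tsum_finsetSum fun _ _ => ENNReal.summable]
  congr 1
  · refine Finset.sum_congr rfl fun j _ => ?_
    rw [hN.tsum_lintegral_generation hμ hθ 0 j (hF 0 j), θ.lintegral_influenceAt_sub, hθ]
    rfl
  · refine Finset.sum_congr rfl fun j _ => ?_
    rw [hN.tsum_lintegral_triggered hμ hθ j (hF 1 j), θ.lintegral_influenceAt_sub, hθ]

theorem IsAncestorHawkes.lintegral_numTriggered (hN : IsAncestorHawkes θ N P)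
    (hμ : ∀ d t, θ.μ d t = μ d)
    (hθ : ∀ n j d, θ.offspringMeasure n j d univ = ENNReal.ofReal (θ.meanOffspring n j d))
    (d : Fin M) {A : Set ℝ} (hA : MeasurableSet A) :
    ∫⁻ ω, numTriggered N d A ω ∂P = (∑' n, θ.generationRate μ (n + 1) d) * volume A := by
  have h1 : ∀ ω, numTriggered N d A ω =
      ∑' u : Event M, {ω | Occurs N u ω}.indicator (fun ω =>
        (if u.depth ≠ 0 ∧ u.dim = d then A.indicator 1 else 0 : ℝ → ℝ≥0∞) (time N u ω)) ω := by
    intro ω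
    refine tsum_congr fun u => ?_
    by_cases ho : Occurs N u ω <;> by_cases ht : time N u ω ∈ A <;>
      by_cases hd : u.dim = d <;> by_cases hu : u.depth = 0 <;>
      simp [ho, ht, hd, hu, u.isTriggered_iff]
  have hm : Measurable (A.indicator (1 : ℝ → ℝ≥0∞)) := measurable_one.indicator hA
  simp_rw [h1]
  rw [lintegral_tsum_event hN.measurable fun u => by split_ifs <;> first | exact hm | fun_prop]
  have h2 := hN.tsum_lintegral_triggered hμ hθ d hm
  rw [lintegral_indicator_one hA] at h2
  rw [← h2]
  refine tsum_congr fun u => ?_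
  split_ifs <;> simp

theorem IsAncestorHawkes.lintegral_numEvents (hN : IsAncestorHawkes θ N P)
    (hμ : ∀ d t, θ.μ d t = μ d)
    (hθ : ∀ n j d, θ.offspringMeasure n j d univ = ENNReal.ofReal (θ.meanOffspring n j d))
    (d : Fin M) {A : Set ℝ} (hA : MeasurableSet A) :
    ∫⁻ ω, numEvents N d A ω ∂P =
      (ENNReal.ofReal (μ d) + ∑' n, θ.generationRate μ (n + 1) d) * volume A := by
  have h1 : ∀ ω, numEvents N d A ω =
      ∑' u : Event M, {ω | Occurs N u ω}.indicator (fun ω =>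
        (if u.dim = d then A.indicator 1 else 0 : ℝ → ℝ≥0∞) (time N u ω)) ω := by
    intro ω
    refine tsum_congr fun u => ?_
    by_cases ho : Occurs N u ω <;> by_cases ht : time N u ω ∈ A <;>
      by_cases hd : u.dim = d <;> simp [ho, ht, hd]
  have hm : Measurable (A.indicator (1 : ℝ → ℝ≥0∞)) := measurable_one.indicator hA
  simp_rw [h1]
  rw [lintegral_tsum_event hN.measurable fun u => by split_ifs <;> first | exact hm | fun_prop]
  have h2 := hN.tsum_lintegral_triggered hμ hθ d hm
  have h3 := hN.tsum_lintegral_generation hμ hθ 0 d hm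
  rw [lintegral_indicator_one hA] at h2 h3
  -- All events are generation 0 together with the triggered ones.
  rw [add_mul, ← h2, ← show θ.generationRate μ 0 d = ENNReal.ofReal (μ d) from rfl, ← h3,
    ← ENNReal.tsum_add]
  refine tsum_congr fun u => ?_
  by_cases hd : u.dim = d <;> by_cases hu : u.depth = 0 <;> simp [hd, hu]

end Means

end AncestorHawkes

theorem mainTheorem2 {M : ℕ} {Ω : Type*} [MeasurableSpace Ω] (P : Measure Ω)
    [IsProbabilityMeasure P]
    (θ : AncestorHawkes.Parameters M)
    (hK : ∀ j d, 0 ≤ θ.K j d) (hL : ∀ j d, 0 ≤ θ.L j d)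
    (hg_meas : ∀ j d, Measurable (θ.g j d)) (hh_meas : ∀ j d, Measurable (θ.h j d))
    (hg_nonneg : ∀ j d, ∀ s, 0 < s → 0 ≤ θ.g j d s)
    (hh_nonneg : ∀ j d, ∀ s, 0 < s → 0 ≤ θ.h j d s)
    (hg_int : ∀ j d, ∫ s in Ioi (0 : ℝ), θ.g j d s = 1)
    (hh_int : ∀ j d, ∫ s in Ioi (0 : ℝ), θ.h j d s = 1)
    (μ : Fin M → ℝ) (hμ_nonneg : ∀ d, 0 ≤ μ d) (hμ : ∀ d t, θ.μ d t = μ d)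
    (hρ : AncestorHawkes.specRadius θ.matL < 1)
    (N : AncestorHawkes.Family M Ω) (hN : AncestorHawkes.IsAncestorHawkes θ N P) :
    IsUnit (1 - θ.matL) ∧
    ∃ r lam : Fin M → ℝ,
      r = ((1 - θ.matL)⁻¹ * θ.matK).mulVec μ ∧
      lam = μ + ((1 - θ.matL)⁻¹ * θ.matK).mulVec μ ∧
      (∀ d, 0 ≤ r d) ∧
      -- the mean triggered and total intensities at every time
      (∀ d t, ∫⁻ ω, AncestorHawkes.triggeredIntensity θ N d t ω ∂P = ENNReal.ofReal (r d)) ∧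
      (∀ d t, ∫⁻ ω, AncestorHawkes.intensity θ N d t ω ∂P = ENNReal.ofReal (lam d)) ∧
      -- the same as mean numbers of triggered events and of all events per unit of time
      (∀ d, ∀ A : Set ℝ, MeasurableSet A →
        ∫⁻ ω, AncestorHawkes.numTriggered N d A ω ∂P = ENNReal.ofReal (r d) * volume A) ∧
      (∀ d, ∀ A : Set ℝ, MeasurableSet A →
        ∫⁻ ω, AncestorHawkes.numEvents N d A ω ∂P = ENNReal.ofReal (lam d) * volume A) := by
  have hθ := θ.offspringMeasure_univ hK hL hg_nonneg hh_nonneg hg_int hh_int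
  have hr := θ.tsum_generationRate hK hL hμ_nonneg hρ
  -- `ENNReal.ofReal` truncates negative values, so splitting the sum relies on the nonnegativity of
  -- both parts.
  have hlam : ∀ d, ENNReal.ofReal ((μ + ((1 - θ.matL)⁻¹ * θ.matK).mulVec μ) d) =
      ENNReal.ofReal (μ d) + ENNReal.ofReal (((1 - θ.matL)⁻¹ * θ.matK).mulVec μ d) := fun d =>
    ENNReal.ofReal_add (hμ_nonneg d) (hr d).1
  have hR : ∀ d t, ∫⁻ ω, AncestorHawkes.triggeredIntensity θ N d t ω ∂P =
      ENNReal.ofReal (((1 - θ.matL)⁻¹ * θ.matK).mulVec μ d) := fun d t => by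
    rw [hN.lintegral_triggeredIntensity hg_meas hh_meas hμ hθ, (hr d).2]
  refine ⟨(AncestorHawkes.hasSum_pow_of_specRadius_lt_one hρ).1, _, _, rfl, rfl,
    fun d => (hr d).1, hR, fun d t => ?_, fun d A hA => ?_, fun d A hA => ?_⟩
  · simp only [AncestorHawkes.intensity, hμ]
    rw [lintegral_add_left measurable_const, hR, hlam, lintegral_const, measure_univ, mul_one]
  · rw [hN.lintegral_numTriggered hμ hθ d hA, (hr d).2]
  · rw [hN.lintegral_numEvents hμ hθ d hA, (hr d).2, hlam]
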